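/- Let $X \neq \{0\}$ be a real Banach space, let $g : X \to X$ be a surjective isometry whose linear part $\hat g(x) = g(x) - g(0)$ is periodic, i.e. $\hat g^{\,p} = \mathrm{id}_X$ for some integer $p \ge 1$, and put $x_* = g^{-1}(0)$. For $t \in [0,\infty)$ let $F_t = \{f_{(1,t)}, \dots, f_{(N,t)}\}$ be a finite family of maps $X \to X$, let $g_t(x) = t\,g(x) + x_*$, and let $F_t^g = F_t \cup \{g_t\}$. Assume that (i) for every $i$ and every $x \in X$ the map $[0,1] \ni t \mapsto f_{(i,t)}(x)$ is continuous, and (ii) $\sup\{\mathrm{Lip}(F_t) : t \in [0,1]\} < 1$, where $\mathrm{Lip}(F_t) = \max_i \mathrm{Lip}(f_{(i,t)})$ is taken with respect to the norm. (Nothing is assumed about $f_{(i,t)}$ for $t > 1$.) For a family $F$ of self-maps of $X$ write $F(S) = \bigcup_{\varphi \in F} \varphi(S)$ for $S \subseteq X$. A nonempty compact set $A$ is called an attractor of $F$ if $F(A) = A$ and there is an open set $U \supseteq A$ such that $F^{(n)}(K) \to A$ in the Hausdorff metric for every nonempty compact $K \subseteq U$. Then: (a) $t_0 = 1$ is a threshold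 for $F_t^g$: the family $F_t^g$ has an attractor for every $t \in [0,1)$ and has no attractor for any $t > 1$. Moreover, for $t \in [0,1)$ the attractor of $F_t^g$ is unique; denote it by $A_t$. (b) $F_t^g$ has a unique upper transition attractor, i.e. there is exactly one nonempty compact set $A^\bullet$ such that $A^\bullet = \lim_{n} A_{t_n}$ in the Hausdorff metric for some increasing sequence $t_n \to 1$ in $[0,1)$. Moreover, the full limit $\lim_{t \to 1^-} A_t$ exists in the Hausdorff metric and equals $A^\bullet$, and $F_1^g(A^\bullet) = A^\bullet$. -/

import Mathlib

open Filter Topology Set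
open scoped ENNReal
open TopologicalSpace (NonemptyCompacts)

noncomputable section

namespace IFS

/-- The Lipschitz constant `sup_{x ≠ y} d(φ x, φ y) / d(x, y)` of a self-map, as an element of
`[0, ∞]`. -/
def lip {X : Type*} [MetricSpace X] (φ : X → X) : ℝ≥0∞ :=
  ⨆ (x : X) (y : X) (_ : x ≠ y), edist (φ x) (φ y) / edist x y

/-- The Lipschitz constant of an iterated function system (a set of self-maps). -/
def lipSystem {X : Type*} [MetricSpace X] (F : Set (X → X)) : ℝ≥0∞ :=
  ⨆ φ ∈ F, lip φ

/-- The Hutchinson operator `S ↦ ⋃_{φ ∈ F} φ(S)`. -/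
def hutchinson {X : Type*} (F : Set (X → X)) (S : Set X) : Set X :=
  ⋃ φ ∈ F, φ '' S

/-- The nonempty compact set `A` is a (strict) attractor of `F`: it is `F`-invariant and has an
open neighbourhood `U` such that the Hutchinson iterates of every nonempty compact `K ⊆ U`
converge to `A` in the Hausdorff metric. -/
def IsAttractor {X : Type*} [MetricSpace X] (F : Set (X → X)) (A : NonemptyCompacts X) : Prop :=
  ∃ U : Set X, IsOpen U ∧ (A : Set X) ⊆ U ∧ hutchinson F (A : Set X) = A ∧
    ∀ K : Set X, K.Nonempty → IsCompact K → K ⊆ U →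
      Tendsto (fun n : ℕ => Metric.hausdorffEDist ((hutchinson F)^[n] K) (A : Set X))
        atTop (𝓝 0)

/-- `t₀` is the threshold for the existence of an attractor of the one-parameter family
`F t`, `t ∈ [0, ∞)`. -/
def IsThreshold {X : Type*} [MetricSpace X] (F : ℝ → Set (X → X)) (t₀ : ℝ) : Prop :=
  (∀ t : ℝ, 0 ≤ t → t < t₀ → ∃ A : NonemptyCompacts X, IsAttractor (F t) A) ∧
  (∀ t : ℝ, 0 ≤ t → t₀ < t → ¬ ∃ A : NonemptyCompacts X, IsAttractor (F t) A)

/-- `A` is an upper transition attractor (at `t = 1`) of the family `F t`: it is the limit, in the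
Hausdorff metric on nonempty compact sets, of attractors of `F (t n)` for some increasing
sequence `t n → 1` in `[0, 1)`. -/
def IsUpperTransitionAttractor {X : Type*} [MetricSpace X] (F : ℝ → Set (X → X))
    (A : NonemptyCompacts X) : Prop :=
  ∃ (t : ℕ → ℝ) (B : ℕ → NonemptyCompacts X),
    StrictMono t ∧ (∀ n, t n ∈ Ico (0 : ℝ) 1) ∧ Tendsto t atTop (𝓝 1) ∧
    (∀ n, IsAttractor (F (t n)) (B n)) ∧ Tendsto B atTop (𝓝 A)

/-- The system `F_t = {f_{(i,t)} : 1 ≤ i ≤ N}`. -/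
def family {X : Type*} {N : ℕ} (f : Fin N → ℝ → X → X) (t : ℝ) : Set (X → X) :=
  range fun i => f i t

/-- The map `g_t(x) = t g(x) + x_*`, where `x_* = g⁻¹(0)`. -/
def scaled {X : Type*} [NormedAddCommGroup X] [NormedSpace ℝ X] (g : X ≃ᵢ X) (t : ℝ) : X → X :=
  fun x => t • g x + g.symm 0

/-- The system `F_t^g = F_t ∪ {g_t}`. -/
def extendedFamily {X : Type*} [NormedAddCommGroup X] [NormedSpace ℝ X] {N : ℕ}
    (f : Fin N → ℝ → X → X) (g : X ≃ᵢ X) (t : ℝ) : Set (X → X) :=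
  family f t ∪ {scaled g t}

/-- The linear part `x ↦ g x - g 0` of the surjective isometry `g` (linear by the Mazur-Ulam
theorem) is periodic: some positive iterate of it is the identity. -/
def HasPeriodicLinearPart {X : Type*} [NormedAddCommGroup X] [NormedSpace ℝ X]
    (g : X ≃ᵢ X) : Prop :=
  ∃ p : ℕ, 0 < p ∧ ∀ x : X, (g.toRealLinearIsometryEquiv)^[p] x = x

end IFS

end

open scoped NNReal

namespace IFS

/-! ### Contracting systems indexed by a compact space. -/

section ParametrizedSystems

variable {P X : Type*} [MetricSpace X]

/-! Write `z` for `x_*` and `L` for the linear part of `g`; then `g_t` is `t • L` centred at `z`.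
For `t < 1` the system is contracting, so Banach's theorem on nonempty compact sets gives the unique
attractor. For `t > 1` the similarity `g_t` separates points geometrically, which no bounded
attractor allows (`not_isAttractor_of_expanding`).

The limit is found in advance: it is the invariant set `A` of the contractions `x ↦ z + s • L ^ j
(f_i x - z)`, with `f_i` taken at `t = 1`, `s ∈ [0, 1]` and `j < p`, together with the constant map
`z` (`exists_starShaped_invariant`). It resembles `A_t` because `A_t` is closed under the iterates
`t ^ n • L ^ n` about `z`; as `L ^ p = 1`, the scalars available for a fixed rotation are `(1 - t ^
p)`-dense in `[0, 1]` (`exists_abs_sub_pow_le`). A farthest-point argument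
(`infDist_le_div_of_forall`) makes the estimate depend only on `1 - c`, although the ratio `t` of
`g_t` tends to one. -/

theorem isCompact_iUnion_image [TopologicalSpace P] [CompactSpace P] {Φ : P → X → X} {K : ℝ≥0}
    (hΦ : ∀ x, Continuous fun p => Φ p x) (hK : ∀ p, LipschitzWith K (Φ p))
    {A : Set X} (hA : IsCompact A) : IsCompact (⋃ p, Φ p '' A) := by
  have hcont : Continuous (Function.uncurry Φ) :=
    continuous_prod_of_continuous_lipschitzWith' _ K hK hΦ
  have heq : (⋃ p, Φ p '' A) = Function.uncurry Φ '' (univ ×ˢ A) := by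
    ext y
    simp [Function.uncurry]
  rw [heq]
  exact (isCompact_univ.prod hA).image hcont

theorem exists_edist_le_of_mem_iUnion_image {Φ : P → X → X} {K : ℝ≥0}
    (hK : ∀ p, LipschitzWith K (Φ p)) (A B : NonemptyCompacts X) :
    ∀ x ∈ ⋃ p, Φ p '' (A : Set X), ∃ y ∈ ⋃ p, Φ p '' (B : Set X),
      edist x y ≤ K * edist A B := by
  intro x hx
  obtain ⟨p, a, ha, rfl⟩ := mem_iUnion.1 hx
  obtain ⟨b, hb, hab⟩ := B.isCompact.exists_infEDist_eq_edist B.nonempty a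
  refine ⟨Φ p b, mem_iUnion.2 ⟨p, b, hb, rfl⟩, (hK p a b).trans ?_⟩
  gcongr
  rw [← hab]
  exact Metric.infEDist_le_hausdorffEDist_of_mem ha

/-- A contracting system with compact parameter space has exactly one nonempty compact invariant
set, which attracts all nonempty compact sets. -/
theorem exists_unique_invariant [TopologicalSpace P] [CompactSpace P] [Nonempty P] [CompleteSpace X] [Nonempty X]
    {Φ : P → X → X} {K : ℝ≥0} (hK1 : K < 1) (hΦ : ∀ x, Continuous fun p => Φ p x)
    (hK : ∀ p, LipschitzWith K (Φ p)) :
    ∃ A : NonemptyCompacts X, (⋃ p, Φ p '' (A : Set X)) = A ∧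
      (∀ B : NonemptyCompacts X, (⋃ p, Φ p '' (B : Set X)) = B → B = A) ∧
      ∀ C : Set X, C.Nonempty → IsCompact C →
        Tendsto (fun n : ℕ => Metric.hausdorffEDist ((fun S => ⋃ p, Φ p '' S)^[n] C) (A : Set X))
          atTop (𝓝 0) := by
  let T : NonemptyCompacts X → NonemptyCompacts X := fun A =>
    ⟨⟨⋃ p, Φ p '' (A : Set X), isCompact_iUnion_image hΦ hK A.isCompact⟩,
      nonempty_iUnion.2 ⟨Classical.arbitrary P, A.nonempty.image _⟩⟩
  have hT : ContractingWith K T := by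
    refine ⟨hK1, fun A B => ?_⟩
    refine Metric.hausdorffEDist_le_of_mem_edist
      (exists_edist_le_of_mem_iUnion_image hK A B) ?_
    rw [edist_comm]
    exact exists_edist_le_of_mem_iUnion_image hK B A
  have : Nonempty (NonemptyCompacts X) := ⟨{Classical.arbitrary X}⟩
  refine ⟨ContractingWith.fixedPoint T hT, ?_, fun B hB => ?_, fun C hne hC => ?_⟩
  · exact congrArg (fun A : NonemptyCompacts X => (A : Set X)) hT.fixedPoint_isFixedPt
  · exact hT.fixedPoint_unique (NonemptyCompacts.ext hB)
  · let C' : NonemptyCompacts X := ⟨⟨C, hC⟩, hne⟩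
    have hiter : ∀ n : ℕ,
        ((T^[n] C' : NonemptyCompacts X) : Set X) = (fun S => ⋃ p, Φ p '' S)^[n] C := by
      intro n
      induction n with
      | zero => rfl
      | succ n ih => rw [Function.iterate_succ_apply', Function.iterate_succ_apply', ← ih]; rfl
    have h := tendsto_iff_edist_tendsto_0.1 (hT.tendsto_iterate_fixedPoint C')
    refine h.congr fun n => ?_
    rw [← hiter]
    rfl

end ParametrizedSystems

section Hutchinson

variable {X : Type*}

theorem mem_hutchinson {F : Set (X → X)} {S : Set X} {φ : X → X} (hφ : φ ∈ F) {x : X}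
    (hx : x ∈ S) : φ x ∈ hutchinson F S :=
  mem_biUnion hφ (mem_image_of_mem φ hx)

theorem iterate_mem_hutchinson_iterate {F : Set (X → X)} {S : Set X} {φ : X → X} (hφ : φ ∈ F)
    {x : X} (hx : x ∈ S) (n : ℕ) : φ^[n] x ∈ (hutchinson F)^[n] S := by
  induction n with
  | zero => exact hx
  | succ n ih =>
    rw [Function.iterate_succ_apply', Function.iterate_succ_apply']
    exact mem_hutchinson hφ ih

end Hutchinson

/-! ### Existence and obstruction for attractors. -/

section Attractors

variable {X : Type*} [MetricSpace X]

theorem lipschitzWith_of_lip_le {φ : X → X} {c : ℝ≥0} (h : lip φ ≤ c) : LipschitzWith c φ := by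
  intro x y
  rcases eq_or_ne x y with rfl | hxy
  · simp
  · have h1 : edist (φ x) (φ y) / edist x y ≤ c :=
      (le_iSup₂_of_le x y (le_iSup (fun _ : x ≠ y => edist (φ x) (φ y) / edist x y) hxy)).trans h
    exact (ENNReal.div_le_iff (edist_pos.2 hxy).ne' (edist_ne_top x y)).1 h1

theorem exists_lipschitzWith_family {N : ℕ} {f : Fin N → ℝ → X → X}
    (hlip : (⨆ t ∈ Icc (0 : ℝ) 1, lipSystem (family f t)) < 1) :
    ∃ c : ℝ≥0, c < 1 ∧ ∀ t ∈ Icc (0 : ℝ) 1, ∀ i, LipschitzWith c (f i t) := by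
  obtain ⟨c, hc⟩ : ∃ c : ℝ≥0, (c : ℝ≥0∞) = ⨆ t ∈ Icc (0 : ℝ) 1, lipSystem (family f t) :=
    ⟨_, ENNReal.coe_toNNReal hlip.ne_top⟩
  refine ⟨c, by rw [← hc] at hlip; exact_mod_cast hlip, fun t ht i => lipschitzWith_of_lip_le ?_⟩
  rw [hc]
  exact le_iSup₂_of_le t ht (le_iSup₂_of_le (f i t) ⟨i, rfl⟩ le_rfl)

/-- A finite system of contractions has exactly one attractor, which is also its only nonempty
compact invariant set. -/
theorem exists_isAttractor_iff [CompleteSpace X] [Nonempty X] {ι : Type*} [Finite ι] [Nonempty ι]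
    {φ : ι → X → X} {K : ℝ≥0} (hK1 : K < 1) (hK : ∀ i, LipschitzWith K (φ i)) :
    ∃ A : NonemptyCompacts X, hutchinson (range φ) (A : Set X) = A ∧
      ∀ B : NonemptyCompacts X, IsAttractor (range φ) B ↔ B = A := by
  let : TopologicalSpace ι := ⊥
  have : DiscreteTopology ι := ⟨rfl⟩
  have hut : hutchinson (range φ) = fun S => ⋃ i, φ i '' S := by
    ext S x
    simp [hutchinson]
  obtain ⟨A, hA, huniq, hlim⟩ := exists_unique_invariant hK1
    (fun x => continuous_of_discreteTopology) hK
  refine ⟨A, by rw [hut]; exact hA, fun B => ⟨?_, ?_⟩⟩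
  · rintro ⟨U, -, -, hB, -⟩
    rw [hut] at hB
    exact huniq B hB
  · rintro rfl
    refine ⟨univ, isOpen_univ, subset_univ _, by rw [hut]; exact hA, fun C hne hC _ => ?_⟩
    rw [hut]
    exact hlim C hne hC

/-- A system that contains a similarity with ratio greater than one has no attractor, provided that
the space has no isolated points. -/
theorem not_isAttractor_of_expanding [∀ x : X, (𝓝[≠] x).NeBot] {F : Set (X → X)} {φ : X → X}
    (hφ : φ ∈ F) {r : ℝ} (hr : 1 < r) (hexp : ∀ x y, dist (φ x) (φ y) = r * dist x y)
    (A : NonemptyCompacts X) : ¬ IsAttractor F A := by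
  rintro ⟨U, hU, hAU, hA, hlim⟩
  have hmaps : ∀ x ∈ (A : Set X), φ x ∈ (A : Set X) := fun x hx => by
    have h := mem_hutchinson hφ hx
    rwa [hA] at h
  have hbdd := A.isCompact.isBounded
  have hiter : ∀ x y : X, ∀ n : ℕ, dist (φ^[n] x) (φ^[n] y) = r ^ n * dist x y := by
    intro x y n
    induction n with
    | zero => simp
    | succ n ih =>
      rw [Function.iterate_succ_apply', Function.iterate_succ_apply', hexp, ih, pow_succ]
      ring
  have hgrow : ∀ x y : X, x ≠ y → Tendsto (fun n => dist (φ^[n] x) (φ^[n] y)) atTop atTop := by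
    intro x y hxy
    simp_rw [hiter]
    exact (tendsto_pow_atTop_atTop_of_one_lt hr).atTop_mul_const (dist_pos.2 hxy)
  obtain ⟨a, ha⟩ := A.nonempty
  have hmapsn : ∀ n : ℕ, φ^[n] a ∈ (A : Set X) := by
    intro n
    induction n with
    | zero => exact ha
    | succ n ih => rw [Function.iterate_succ_apply']; exact hmaps _ ih
  obtain ⟨x, hxU, hxa⟩ : ∃ x, x ∈ U ∧ x ≠ a := by
    have h1 : ∀ᶠ x in 𝓝[≠] a, x ∈ U := nhdsWithin_le_nhds (hU.mem_nhds (hAU ha))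
    exact (h1.and self_mem_nhdsWithin).exists
  have hK := hlim {x} (singleton_nonempty x) isCompact_singleton (singleton_subset_iff.2 hxU)
  have hev : ∀ᶠ n in atTop,
      Metric.hausdorffEDist ((hutchinson F)^[n] {x}) (A : Set X) < 1 :=
    hK.eventually_lt_const one_pos
  -- The orbit of `x` is then within 1 of `A`, yet farther than `1 + diam A` from the orbit of `a`,
  -- which stays in `A`.
  obtain ⟨n, hn1, hn2⟩ :=
    (hev.and ((hgrow x a hxa).eventually_gt_atTop (1 + Metric.diam (A : Set X)))).exists
  obtain ⟨b, hb, hxb⟩ := Metric.exists_edist_lt_of_hausdorffEDist_lt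
    (iterate_mem_hutchinson_iterate hφ (mem_singleton x) n) hn1
  have h1 : dist (φ^[n] x) b < 1 := by
    rw [edist_dist] at hxb
    simpa using hxb
  have h2 := Metric.dist_le_diam_of_mem hbdd hb (hmapsn n)
  linarith [dist_triangle (φ^[n] x) b (φ^[n] a)]

end Attractors

/-! ### The similarity `g_t` and powers of its ratio. -/

section Similarities

variable {X : Type*} [NormedAddCommGroup X] [NormedSpace ℝ X]

theorem scaled_apply (g : X ≃ᵢ X) (t : ℝ) (x : X) :
    scaled g t x = g.symm 0 + t • g.toRealLinearIsometryEquiv (x - g.symm 0) := by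
  rw [map_sub, g.toRealLinearIsometryEquiv_apply, g.toRealLinearIsometryEquiv_apply,
    g.apply_symm_apply, scaled, add_comm]
  simp

theorem dist_scaled (g : X ≃ᵢ X) {t : ℝ} (ht : 0 ≤ t) (x y : X) :
    dist (scaled g t x) (scaled g t y) = t * dist x y := by
  rw [scaled, scaled, dist_add_right, dist_smul₀, g.dist_eq, Real.norm_of_nonneg ht]

theorem extendedFamily_eq_range {N : ℕ} (f : Fin N → ℝ → X → X) (g : X ≃ᵢ X) (t : ℝ) :
    extendedFamily f g t = range (Sum.elim (fun i => f i t) fun _ : Unit => scaled g t) := by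
  rw [Sum.elim_range, extendedFamily, family, range_const]

theorem iterate_scaled_apply (g : X ≃ᵢ X) (t : ℝ) (n : ℕ) (x : X) :
    (scaled g t)^[n] x
      = g.symm 0 + t ^ n • (g.toRealLinearIsometryEquiv ^ n) (x - g.symm 0) := by
  induction n with
  | zero => simp
  | succ n ih =>
    rw [Function.iterate_succ_apply', ih, scaled_apply, add_sub_cancel_left, map_smul, smul_smul,
      pow_succ' t, pow_succ' g.toRealLinearIsometryEquiv]
    rfl

theorem coe_pow_linearIsometryEquiv (L : X ≃ₗᵢ[ℝ] X) (n : ℕ) : ⇑(L ^ n) = L^[n] :=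
  hom_coe_pow _ rfl (fun _ _ => rfl) _ _

theorem HasPeriodicLinearPart.exists_pow_eq_one {g : X ≃ᵢ X} (hg : HasPeriodicLinearPart g) :
    ∃ p : ℕ, 0 < p ∧ g.toRealLinearIsometryEquiv ^ p = 1 := by
  obtain ⟨p, hp, h⟩ := hg
  refine ⟨p, hp, LinearIsometryEquiv.ext fun x => ?_⟩
  rw [coe_pow_linearIsometryEquiv]
  exact h x

/-- Every number in `[0, 1]` is within `1 - t ^ p` of a power of `t` whose exponent has
a prescribed residue modulo `p`. -/
theorem exists_abs_sub_pow_le {t s : ℝ} (ht0 : 0 ≤ t) (ht1 : t < 1) (hs0 : 0 ≤ s) (hs1 : s ≤ 1)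
    {p j : ℕ} (hp : 0 < p) (hj : j ≤ p) :
    ∃ q : ℕ, |s - t ^ (p * q + j)| ≤ 1 - t ^ p := by
  have hδ : 0 < 1 - t ^ p := sub_pos.2 (pow_lt_one₀ ht0 ht1 hp.ne')
  have hex : ∃ q : ℕ, t ^ (p * q + j) ≤ s + (1 - t ^ p) := by
    have h1 : Tendsto (fun q : ℕ => t ^ (p * q + j)) atTop (𝓝 0) :=
      (tendsto_pow_atTop_nhds_zero_of_lt_one ht0 ht1).comp
        (tendsto_atTop_mono (fun q => (Nat.le_mul_of_pos_left q hp).trans (Nat.le_add_right _ _))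
          tendsto_id)
    exact (h1.eventually_le_const (by linarith)).exists
  classical
  -- Take the first power that drops to `s + (1 - t ^ p)`: the preceding one lies above, and a
  -- factor `t ^ p` lowers it by at most `1 - t ^ p`.
  refine ⟨Nat.find hex, abs_le.2 ⟨by linarith [Nat.find_spec hex], ?_⟩⟩
  rcases hq : Nat.find hex with _ | q
  · have h1 : t ^ p ≤ t ^ j := pow_le_pow_of_le_one ht0 ht1.le hj
    rw [mul_zero, zero_add]
    linarith
  · have h1 := Nat.find_min hex (m := q) (by omega)
    push Not at h1
    have h2 : t ^ (p * (q + 1) + j) = t ^ (p * q + j) * t ^ p := by rw [← pow_add]; ring_nf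
    have h3 : t ^ (p * q + j) ≤ 1 := pow_le_one₀ ht0 ht1.le
    rw [h2]
    nlinarith

end Similarities

/-- Apply the hypothesis at a point of `A` farthest from `B`. The error-free alternative forces the
maximal distance to vanish, so its ratio `t` never enters the bound. -/
theorem infDist_le_div_of_forall {X : Type*} [MetricSpace X] (A : NonemptyCompacts X) (B : Set X)
    {c e : ℝ} (hc0 : 0 ≤ c) (hc : c < 1) (he : 0 ≤ e)
    (h : ∀ a ∈ (A : Set X), ∃ b ∈ (A : Set X),
      Metric.infDist a B ≤ c * Metric.infDist b B + e ∨
        ∃ t < 1, Metric.infDist a B ≤ t * Metric.infDist b B) :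
    ∀ a ∈ (A : Set X), Metric.infDist a B ≤ e / (1 - c) := by
  obtain ⟨m, hm, hmax⟩ := A.isCompact.exists_isMaxOn A.nonempty
    (Metric.continuous_infDist_pt B).continuousOn
  have hc' : 0 < 1 - c := sub_pos.2 hc
  have hm0 : 0 ≤ Metric.infDist m B := Metric.infDist_nonneg
  refine fun a ha => (hmax ha).trans ?_
  obtain ⟨b, hb, hmb | ⟨t, ht, hmb⟩⟩ := h m hm
  · have hbm : Metric.infDist b B ≤ Metric.infDist m B := hmax hb
    rw [le_div_iff₀ hc']
    nlinarith [mul_le_mul_of_nonneg_left hbm hc0]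
  · have hbm : Metric.infDist b B ≤ Metric.infDist m B := hmax hb
    have hb0 : 0 ≤ Metric.infDist b B := Metric.infDist_nonneg
    have hle : Metric.infDist m B ≤ 0 := by
      by_contra! hpos
      rcases le_or_gt 0 t with h0 | h0 <;> nlinarith
    exact hle.trans (by positivity)

/-- On a compact set, maps that are continuous in the parameter and uniformly Lipschitz in the
variable converge uniformly. -/
theorem eventually_forall_dist_le {X : Type*} [MetricSpace X] {N : ℕ} {f : Fin N → ℝ → X → X} {c : ℝ≥0}
    (hcont : ∀ (i : Fin N) (x : X), ContinuousOn (fun t : ℝ => f i t x) (Icc 0 1))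
    (hf : ∀ t ∈ Icc (0 : ℝ) 1, ∀ i, LipschitzWith c (f i t)) {A : Set X} (hA : IsCompact A)
    {ε : ℝ} (hε : 0 < ε) :
    ∀ᶠ t in 𝓝[Icc 0 1] (1 : ℝ), ∀ i, ∀ x ∈ A, dist (f i t x) (f i 1 x) ≤ ε := by
  refine eventually_all.2 fun i => ?_
  have hprod : ContinuousOn (Function.uncurry (f i)) (Icc (0 : ℝ) 1 ×ˢ A) :=
    continuousOn_prod_of_continuousOn_lipschitzOnWith' _ c
      (fun t ht => (hf t ht i).lipschitzOnWith) fun x _ => hcont i x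
  obtain ⟨v, hv, h⟩ := hA.mem_uniformity_of_prod hprod (q := 1) (by simp)
    (Metric.dist_mem_uniformity hε)
  filter_upwards [hv] with t ht x hx
  exact (h t ht x hx).le

/-! ### The star-shaped limit set and convergence to it. -/

section Star

variable {X : Type*} [NormedAddCommGroup X] [NormedSpace ℝ X]

/-- For a system of contractions and a periodic linear isometry `L` there is a nonempty compact set
that is star-shaped about `z`, invariant under the rotation `L` about `z`, and generated by the
images under the contractions. -/
theorem exists_starShaped_invariant [CompleteSpace X] (L : X ≃ₗᵢ[ℝ] X) {p : ℕ} (hp : 0 < p)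
    (hL : L ^ p = 1) (z : X) {N : ℕ} {f : Fin N → X → X} {c : ℝ≥0} (hc : c < 1)
    (hf : ∀ i, LipschitzWith c (f i)) :
    ∃ A : NonemptyCompacts X,
      (∀ i, ∀ x ∈ (A : Set X), f i x ∈ (A : Set X)) ∧
      (∀ s ∈ Icc (0 : ℝ) 1, ∀ k : ℕ, ∀ x ∈ (A : Set X), z + s • (L ^ k) (x - z) ∈ (A : Set X)) ∧
      ∀ x ∈ (A : Set X), x = z ∨ ∃ s ∈ Icc (0 : ℝ) 1, ∃ j < p, ∃ i, ∃ y ∈ (A : Set X),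
        x = z + s • (L ^ j) (f i y - z) := by
  -- The constant branch puts `z` in the invariant set and keeps the parameter space nonempty when
  -- `N = 0`.
  let Φ : Unit ⊕ (Icc (0 : ℝ) 1 × Fin p × Fin N) → X → X :=
    Sum.elim (fun _ _ => z) fun q x => z + (q.1 : ℝ) • (L ^ (q.2.1 : ℕ)) (f q.2.2 x - z)
  have hΦ : ∀ x, Continuous fun q => Φ q x := by
    intro x
    refine continuous_sum_dom.2 ⟨continuous_const, ?_⟩
    exact continuous_const.add ((continuous_subtype_val.comp continuous_fst).smul
      ((continuous_of_discreteTopology (f := fun r : Fin p × Fin N =>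
        (L ^ (r.1 : ℕ)) (f r.2 x - z))).comp continuous_snd))
  have hK : ∀ q, LipschitzWith c (Φ q) := by
    rintro (_ | ⟨s, j, i⟩)
    · exact LipschitzWith.const' z
    · refine LipschitzWith.of_dist_le_mul fun x y => ?_
      simp only [Φ, Sum.elim_inr]
      rw [dist_add_left, dist_smul₀, LinearIsometryEquiv.dist_map, dist_sub_right,
        Real.norm_of_nonneg s.2.1]
      exact (mul_le_of_le_one_left dist_nonneg s.2.2).trans ((hf i).dist_le_mul x y)
  obtain ⟨A, hA, -, -⟩ := exists_unique_invariant hc hΦ hK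
  have hz : z ∈ (A : Set X) := by
    rw [← hA]
    obtain ⟨a, ha⟩ := A.nonempty
    exact mem_iUnion.2 ⟨Sum.inl (), a, ha, rfl⟩
  have hmem : ∀ s ∈ Icc (0 : ℝ) 1, ∀ k : ℕ, ∀ i, ∀ y ∈ (A : Set X),
      z + s • (L ^ k) (f i y - z) ∈ (A : Set X) := by
    intro s hs k i y hy
    rw [pow_eq_pow_mod k hL, ← hA]
    exact mem_iUnion.2 ⟨Sum.inr (⟨s, hs⟩, ⟨k % p, Nat.mod_lt k hp⟩, i), y, hy, rfl⟩
  have hstruct : ∀ x ∈ (A : Set X), x = z ∨ ∃ s ∈ Icc (0 : ℝ) 1, ∃ j < p, ∃ i,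
      ∃ y ∈ (A : Set X), x = z + s • (L ^ j) (f i y - z) := by
    intro x hx
    rw [← hA] at hx
    obtain ⟨_ | ⟨s, j, i⟩, y, hy, rfl⟩ := mem_iUnion.1 hx
    · exact Or.inl rfl
    · exact Or.inr ⟨s, s.2, j, j.2, i, y, hy, rfl⟩
  refine ⟨A, fun i x hx => ?_, fun s hs k x hx => ?_, hstruct⟩
  · simpa using hmem 1 (by simp) 0 i x hx
  · obtain rfl | ⟨s', hs', j, -, i, y, hy, rfl⟩ := hstruct x hx
    · simpa using hz
    · have h := hmem (s * s') ⟨mul_nonneg hs.1 hs'.1, mul_le_one₀ hs.2 hs'.1 hs'.2⟩ (k + j) i y hy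
      rwa [mul_smul, pow_add, LinearIsometryEquiv.coe_mul, Function.comp_apply, ← map_smul,
        ← add_sub_cancel_left z (s' • (L ^ j) (f i y - z))] at h

theorem hutchinson_extendedFamily_one_eq {N : ℕ} {f : Fin N → ℝ → X → X} {g : X ≃ᵢ X} {p : ℕ}
    (hp : 0 < p) (hL : g.toRealLinearIsometryEquiv ^ p = 1) {A : NonemptyCompacts X}
    (hA1 : ∀ i, ∀ x ∈ (A : Set X), f i 1 x ∈ (A : Set X))
    (hA2 : ∀ s ∈ Icc (0 : ℝ) 1, ∀ k : ℕ, ∀ x ∈ (A : Set X),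
      g.symm 0 + s • (g.toRealLinearIsometryEquiv ^ k) (x - g.symm 0) ∈ (A : Set X)) :
    hutchinson (extendedFamily f g 1) (A : Set X) = A := by
  refine Subset.antisymm (iUnion₂_subset ?_) fun x hx => ?_
  · rintro φ (⟨i, rfl⟩ | rfl)
    · rintro _ ⟨x, hx, rfl⟩
      exact hA1 i x hx
    · rintro _ ⟨x, hx, rfl⟩
      rw [scaled_apply]
      simpa using hA2 1 (by simp) 1 x hx
  -- `L ^ (p - 1)` inverts `L`, so `x` already has a preimage in `A` under `g_1`.
  · have h1 := mem_hutchinson (F := extendedFamily f g 1) (Or.inr rfl)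
      (hA2 1 (by simp) (p - 1) x hx)
    rwa [scaled_apply, add_sub_cancel_left, one_smul, one_smul, ← Function.comp_apply
      (f := g.toRealLinearIsometryEquiv), ← LinearIsometryEquiv.coe_mul, mul_pow_sub_one hp.ne',
      hL, LinearIsometryEquiv.coe_one, id, add_sub_cancel] at h1

theorem dist_smul_map_le (L : X ≃ₗᵢ[ℝ] X) (z x y : X) {s r : ℝ} (hr0 : 0 ≤ r) (hr1 : r ≤ 1) :
    dist (z + s • L (x - z)) (z + r • L (y - z)) ≤ |s - r| * dist x z + dist x y := by
  have h1 : dist (s • L (x - z)) (r • L (x - z)) = |s - r| * dist x z := by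
    rw [dist_eq_norm, ← sub_smul, norm_smul, L.norm_map, Real.norm_eq_abs, dist_eq_norm]
  have h2 : dist (r • L (x - z)) (r • L (y - z)) ≤ dist x y := by
    rw [dist_smul₀, L.dist_map, dist_sub_right, Real.norm_of_nonneg hr0]
    exact mul_le_of_le_one_left dist_nonneg hr1
  rw [dist_add_left]
  exact (dist_triangle _ (r • L (x - z)) _).trans (by rw [h1]; gcongr)

/-- Distance between an invariant set of `F_t^g` and the star-shaped invariant set at `t = 1`. -/
theorem hausdorffDist_le_of_invariant {N : ℕ} {f : Fin N → ℝ → X → X} {g : X ≃ᵢ X} {p : ℕ}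
    (hp : 0 < p) (hL : g.toRealLinearIsometryEquiv ^ p = 1) {A B : NonemptyCompacts X}
    (hA1 : ∀ i, ∀ x ∈ (A : Set X), f i 1 x ∈ (A : Set X))
    (hA2 : ∀ s ∈ Icc (0 : ℝ) 1, ∀ k : ℕ, ∀ x ∈ (A : Set X),
      g.symm 0 + s • (g.toRealLinearIsometryEquiv ^ k) (x - g.symm 0) ∈ (A : Set X))
    (hA3 : ∀ x ∈ (A : Set X), x = g.symm 0 ∨ ∃ s ∈ Icc (0 : ℝ) 1, ∃ j < p, ∃ i,
      ∃ y ∈ (A : Set X),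
        x = g.symm 0 + s • (g.toRealLinearIsometryEquiv ^ j) (f i 1 y - g.symm 0))
    {t : ℝ} (ht : t ∈ Ico (0 : ℝ) 1)
    (hB : hutchinson (extendedFamily f g t) (B : Set X) = B)
    {c : ℝ≥0} (hc : c < 1) (hf : ∀ i, LipschitzWith c (f i t)) {ε R : ℝ} (hε : 0 ≤ ε)
    (hdist : ∀ i, ∀ x ∈ (A : Set X), dist (f i t x) (f i 1 x) ≤ ε)
    (hR : ∀ x ∈ (A : Set X), dist x (g.symm 0) ≤ R) (hRt : (1 - t ^ p) * R ≤ ε) :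
    dist B A ≤ 2 * ε / (1 - c) := by
  set z := g.symm 0 with hz
  set L := g.toRealLinearIsometryEquiv with hLdef
  have hc1 : (c : ℝ) < 1 := by exact_mod_cast hc
  have hB1 : ∀ i, ∀ x ∈ (B : Set X), f i t x ∈ (B : Set X) := fun i x hx => by
    have h := mem_hutchinson (F := extendedFamily f g t) (Or.inl ⟨i, rfl⟩) hx
    rwa [hB] at h
  have hB2 : ∀ n : ℕ, ∀ x ∈ (B : Set X), z + t ^ n • (L ^ n) (x - z) ∈ (B : Set X) := by
    intro n x hx
    have h := iterate_mem_hutchinson_iterate (F := extendedFamily f g t) (Or.inr rfl) hx n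
    rwa [iterate_scaled_apply, Function.iterate_fixed hB] at h
  have hB3 : ∀ x ∈ (B : Set X), (∃ i, ∃ y ∈ (B : Set X), x = f i t y) ∨
      ∃ y ∈ (B : Set X), x = z + t • L (y - z) := by
    intro x hx
    rw [← hB] at hx
    obtain ⟨φ, ⟨i, rfl⟩ | rfl, y, hy, rfl⟩ := mem_iUnion₂.1 hx
    · exact Or.inl ⟨i, y, hy, rfl⟩
    · exact Or.inr ⟨y, hy, scaled_apply g t y⟩
  -- `z` is the limit of every `g_t`-orbit, and `B` is closed.
  have hzB : z ∈ (B : Set X) := by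
    obtain ⟨b, hb⟩ := B.nonempty
    refine B.isCompact.isClosed.mem_of_tendsto (b := atTop) ?_
      (Eventually.of_forall fun n => hB2 n b hb)
    rw [tendsto_iff_dist_tendsto_zero]
    have h1 : ∀ n : ℕ, dist (z + t ^ n • (L ^ n) (b - z)) z = t ^ n * ‖b - z‖ := fun n => by
      rw [dist_self_add_left, norm_smul, LinearIsometryEquiv.norm_map,
        Real.norm_of_nonneg (pow_nonneg ht.1 n)]
    simp_rw [h1]
    simpa using (tendsto_pow_atTop_nhds_zero_of_lt_one ht.1 ht.2).mul_const ‖b - z‖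
  have hBA : ∀ a ∈ (B : Set X), Metric.infDist a A ≤ 2 * ε / (1 - c) := by
    refine infDist_le_div_of_forall B A c.2 hc1 (by positivity) fun a ha => ?_
    obtain ⟨i, b, hb, rfl⟩ | ⟨b, hb, rfl⟩ := hB3 a ha
    · obtain ⟨b', hb', hbb'⟩ := A.isCompact.exists_infDist_eq_dist A.nonempty b
      refine ⟨b, hb, Or.inl ((Metric.infDist_le_dist_of_mem (hA1 i b' hb')).trans ?_)⟩
      rw [hbb']
      linarith [dist_triangle (f i t b) (f i t b') (f i 1 b'), (hf i).dist_le_mul b b',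
        hdist i b' hb']
    · obtain ⟨b', hb', hbb'⟩ := A.isCompact.exists_infDist_eq_dist A.nonempty b
      refine ⟨b, hb, Or.inr ⟨t, ht.2, ?_⟩⟩
      refine (Metric.infDist_le_dist_of_mem (hA2 t ⟨ht.1, ht.2.le⟩ 1 b' hb')).trans ?_
      rw [pow_one, dist_add_left, dist_smul₀, L.dist_map, dist_sub_right,
        Real.norm_of_nonneg ht.1, hbb']
  have hAB : ∀ a ∈ (A : Set X), Metric.infDist a B ≤ 2 * ε / (1 - c) := by
    refine infDist_le_div_of_forall A B c.2 hc1 (by positivity) fun a ha => ?_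
    obtain rfl | ⟨s, hs, j, hj, i, y, hy, rfl⟩ := hA3 a ha
    · exact ⟨_, ha, Or.inr ⟨0, one_pos, by rw [Metric.infDist_zero_of_mem hzB]; simp⟩⟩
    · obtain ⟨b', hb', hbb'⟩ := B.isCompact.exists_infDist_eq_dist B.nonempty y
      -- The exponent is `j` modulo `p`, so the rotation is exactly `L ^ j` and only the scalar is
      -- approximated. This costs one `ε`; passing from `f i 1` to `f i t` costs the other.
      obtain ⟨q, hq⟩ := exists_abs_sub_pow_le ht.1 ht.2 hs.1 hs.2 hp hj.le
      have hk : L ^ (p * q + j) = L ^ j := by rw [pow_add, pow_mul, hL, one_pow, one_mul]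
      have hmem := hB2 (p * q + j) _ (hB1 i b' hb')
      rw [hk] at hmem
      refine ⟨y, hy, Or.inl ((Metric.infDist_le_dist_of_mem hmem).trans ?_)⟩
      refine (dist_smul_map_le (L ^ j) z _ _ (pow_nonneg ht.1 _)
        (pow_le_one₀ ht.1 ht.2.le)).trans ?_
      have h1 : |s - t ^ (p * q + j)| * dist (f i 1 y) z ≤ (1 - t ^ p) * R :=
        mul_le_mul hq (hR _ (hA1 i y hy)) dist_nonneg ((abs_nonneg _).trans hq)
      have h2 := dist_triangle_left (f i 1 y) (f i t b') (f i t y)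
      rw [hbb']
      linarith [(hf i).dist_le_mul y b', hdist i y hy]
  rw [Metric.NonemptyCompacts.dist_eq]
  exact Metric.hausdorffDist_le_of_infDist
    (div_nonneg (by positivity) (sub_pos.2 hc1).le) hBA hAB

theorem tendsto_of_invariant {N : ℕ} {f : Fin N → ℝ → X → X} {g : X ≃ᵢ X} {p : ℕ}
    (hp : 0 < p) (hL : g.toRealLinearIsometryEquiv ^ p = 1) {A : NonemptyCompacts X}
    (hA1 : ∀ i, ∀ x ∈ (A : Set X), f i 1 x ∈ (A : Set X))
    (hA2 : ∀ s ∈ Icc (0 : ℝ) 1, ∀ k : ℕ, ∀ x ∈ (A : Set X),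
      g.symm 0 + s • (g.toRealLinearIsometryEquiv ^ k) (x - g.symm 0) ∈ (A : Set X))
    (hA3 : ∀ x ∈ (A : Set X), x = g.symm 0 ∨ ∃ s ∈ Icc (0 : ℝ) 1, ∃ j < p, ∃ i,
      ∃ y ∈ (A : Set X),
        x = g.symm 0 + s • (g.toRealLinearIsometryEquiv ^ j) (f i 1 y - g.symm 0))
    {c : ℝ≥0} (hc : c < 1)
    (hcont : ∀ (i : Fin N) (x : X), ContinuousOn (fun t : ℝ => f i t x) (Icc 0 1))
    (hf : ∀ t ∈ Icc (0 : ℝ) 1, ∀ i, LipschitzWith c (f i t)) {B : ℝ → NonemptyCompacts X}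
    (hB : ∀ t ∈ Ico (0 : ℝ) 1, hutchinson (extendedFamily f g t) (B t : Set X) = B t) :
    Tendsto B (𝓝[<] 1) (𝓝 A) := by
  have hc1 : 0 < 1 - (c : ℝ) := sub_pos.2 (by exact_mod_cast hc)
  rw [Metric.tendsto_nhds]
  intro δ hδ
  -- With this `ε` the bound `2 * ε / (1 - c)` equals `δ / 2`.
  have hε : 0 < δ * (1 - c) / 4 := by positivity
  obtain ⟨R, hR⟩ := A.isCompact.isBounded.subset_closedBall (g.symm 0)
  have hIco : Ico (0 : ℝ) 1 ∈ 𝓝[<] (1 : ℝ) := Ico_mem_nhdsLT one_pos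
  have hle : 𝓝[<] (1 : ℝ) ≤ 𝓝[Icc 0 1] 1 :=
    nhdsWithin_le_of_mem (mem_of_superset hIco Ico_subset_Icc_self)
  have hpow : ∀ᶠ t in 𝓝[<] (1 : ℝ), (1 - t ^ p) * R ≤ δ * (1 - c) / 4 := by
    have h1 : Tendsto (fun t : ℝ => (1 - t ^ p) * R) (𝓝 1) (𝓝 0) := by
      have h2 : Continuous fun t : ℝ => (1 - t ^ p) * R := by fun_prop
      simpa using h2.tendsto 1
    exact nhdsWithin_le_nhds (h1.eventually_le_const hε)
  filter_upwards [hIco, hpow, hle (eventually_forall_dist_le hcont hf A.isCompact hε)]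
    with t ht hRt hdist
  refine (hausdorffDist_le_of_invariant hp hL hA1 hA2 hA3 ht (hB t ht) hc
    (hf t ⟨ht.1, ht.2.le⟩) hε.le hdist (fun x hx => hR hx) hRt).trans_lt ?_
  rw [div_lt_iff₀ hc1]
  nlinarith

end Star

end IFS

/-! ### Assembly. -/

theorem mainTheorem1 {X : Type*} [NormedAddCommGroup X] [NormedSpace ℝ X] [CompleteSpace X]
    [Nontrivial X] (g : X ≃ᵢ X) (hg : IFS.HasPeriodicLinearPart g)
    {N : ℕ} (f : Fin N → ℝ → X → X)
    (hcont : ∀ (i : Fin N) (x : X), ContinuousOn (fun t : ℝ => f i t x) (Set.Icc 0 1))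
    (hlip : (⨆ t ∈ Set.Icc (0 : ℝ) 1, IFS.lipSystem (IFS.family f t)) < 1) :
    IFS.IsThreshold (IFS.extendedFamily f g) 1 ∧
    (∃! A : TopologicalSpace.NonemptyCompacts X,
      IFS.IsUpperTransitionAttractor (IFS.extendedFamily f g) A) ∧
    ∃ (A : ℝ → TopologicalSpace.NonemptyCompacts X)
      (Aupper : TopologicalSpace.NonemptyCompacts X),
      (∀ t ∈ Set.Ico (0 : ℝ) 1, ∀ B : TopologicalSpace.NonemptyCompacts X,
        IFS.IsAttractor (IFS.extendedFamily f g t) B ↔ B = A t) ∧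
      Filter.Tendsto A (nhdsWithin 1 (Set.Iio 1)) (nhds Aupper) ∧
      IFS.hutchinson (IFS.extendedFamily f g 1) (Aupper : Set X) = Aupper ∧
      IFS.IsUpperTransitionAttractor (IFS.extendedFamily f g) Aupper := by
  obtain ⟨p, hp, hL⟩ := hg.exists_pow_eq_one
  obtain ⟨c, hc, hf⟩ := IFS.exists_lipschitzWith_family hlip
  have hattr : ∀ t : ℝ, ∃ A : NonemptyCompacts X, t ∈ Ico (0 : ℝ) 1 →
      IFS.hutchinson (IFS.extendedFamily f g t) (A : Set X) = A ∧
      ∀ B : NonemptyCompacts X, IFS.IsAttractor (IFS.extendedFamily f g t) B ↔ B = A := by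
    intro t
    by_cases ht : t ∈ Ico (0 : ℝ) 1
    · have hK : ∀ i, LipschitzWith (max c t.toNNReal)
          (Sum.elim (fun i => f i t) (fun _ : Unit => IFS.scaled g t) i) := by
        rintro (i | _)
        · exact (hf t ⟨ht.1, ht.2.le⟩ i).weaken (le_max_left _ _)
        · refine LipschitzWith.weaken (LipschitzWith.of_dist_le_mul fun x y => ?_)
            (le_max_right _ _)
          rw [Real.coe_toNNReal t ht.1]
          exact (IFS.dist_scaled g ht.1 x y).le
      rw [IFS.extendedFamily_eq_range]
      obtain ⟨A, hA⟩ :=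
        IFS.exists_isAttractor_iff (max_lt hc (Real.toNNReal_lt_one.2 ht.2)) hK
      exact ⟨A, fun _ => hA⟩
    · exact ⟨{0}, fun h => absurd h ht⟩
  choose A hA using hattr
  obtain ⟨Aup, hA1, hA2, hA3⟩ := IFS.exists_starShaped_invariant g.toRealLinearIsometryEquiv hp hL
    (g.symm 0) hc (hf 1 (by simp))
  have hlim : Tendsto A (𝓝[<] 1) (𝓝 Aup) :=
    IFS.tendsto_of_invariant hp hL hA1 hA2 hA3 hc hcont hf fun t ht => (hA t ht).1
  have hupper : IFS.IsUpperTransitionAttractor (IFS.extendedFamily f g) Aup := by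
    obtain ⟨t, hmono, hmem, ht⟩ := exists_seq_strictMono_tendsto' (zero_lt_one (α := ℝ))
    have hmem' : ∀ n, t n ∈ Ico (0 : ℝ) 1 := fun n => Ioo_subset_Ico_self (hmem n)
    refine ⟨t, A ∘ t, hmono, hmem', ht, fun n => ((hA _ (hmem' n)).2 _).2 rfl, ?_⟩
    exact hlim.comp (tendsto_nhdsWithin_iff.2 ⟨ht, Eventually.of_forall fun n => (hmem' n).2⟩)
  refine ⟨⟨fun t h0 h1 => ⟨A t, ((hA t ⟨h0, h1⟩).2 _).2 rfl⟩, ?_⟩,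
    ⟨Aup, hupper, ?_⟩, A, Aup, fun t ht => (hA t ht).2, hlim,
    IFS.hutchinson_extendedFamily_one_eq hp hL hA1 hA2, hupper⟩
  · rintro t h0 h1 ⟨B, hB⟩
    have : ∀ x : X, (𝓝[≠] x).NeBot := fun x => Module.punctured_nhds_neBot ℝ X x
    exact IFS.not_isAttractor_of_expanding (Or.inr rfl) h1 (IFS.dist_scaled g h0) B hB
  · rintro C ⟨t, B, -, hmem, ht, hB, hBC⟩
    have hBA : B = A ∘ t := funext fun n => ((hA _ (hmem n)).2 _).1 (hB n)
    rw [hBA] at hBC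
    exact tendsto_nhds_unique hBC (hlim.comp
      (tendsto_nhdsWithin_iff.2 ⟨ht, Eventually.of_forall fun n => (hmem n).2⟩))
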